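/- Let $C$ be a commutative ring, $\lambda\in C$ an invertible element, $A$ a commutative $C$-algebra, and $p$ a prime number. Let $\mathrm{Sha}_C(A)=\mathrm{Sha}_{C,\lambda}(A)$ be the free Baxter $C$-algebra of weight $\lambda$ on $A$, realized as the mixable shuffle Baxter algebra: its $C$-module is $\bigoplus_{n\ge 1}A^{\otimes n}$ (tensor powers over $C$); its multiplication is the $C$-bilinear mixable shuffle product determined recursively, for $a_0,b_0\in A$ and $x\in A^{\otimes m}$, $y\in A^{\otimes n}$ with $m,n\ge 1$, by $$a_0\cdot b_0=a_0b_0,\qquad a_0\cdot(b_0\otimes y)=a_0b_0\otimes y,\qquad (a_0\otimes x)\cdot b_0=a_0b_0\otimes x,$$ $$(a_0\otimes x)\cdot(b_0\otimes y)=a_0b_0\otimes\bigl(x\cdot(1\otimes y)+(1\otimes x)\cdot y+\lambda\,x\cdot y\bigr);$$ and its Baxter operator is $P_A(a_1\otimes\cdots\otimes a_n)=1\otimes a_1\otimes\cdots\otimes a_n$. This is a commutative $C$-algebra, and $A$ is embedded in it as $A^{\otimes 1}$. A Baxter ideal of $\mathrm{Sha}_C(A)$ is an ideal $I$ with $P_A(I)\subseteq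 I$; the Baxter ideal generated by a subset is the smallest Baxter ideal containing it. Powers of elements of $\mathrm{Sha}_C(A)$ are taken with respect to the mixable shuffle product, and "mod $p$" means modulo the ideal $p\,\mathrm{Sha}_C(A)$. 1. For all $n\ge 1$ and $a_1,\dots,a_n\in A$, $$(a_1\otimes\cdots\otimes a_n)^p\equiv \lambda^{(n-1)(p-1)}\,a_1^p\otimes\cdots\otimes a_n^p \pmod p.$$ In particular, if $\lambda=1$, then $(a_1\otimes\cdots\otimes a_n)^p\equiv a_1^p\otimes\cdots\otimes a_n^p \pmod p$. 2. Let $I$ be the Baxter ideal of $\mathrm{Sha}_C(A)$ generated by $p$ and $\{a^p-a : a\in A\}$. Then $a^p\equiv a \pmod I$ for every $a\in \mathrm{Sha}_C(A)$. 3. If $A$ has characteristic $p$ and $a^p=a$ for all $a\in A$, then $a^p=a$ for all $a\in \mathrm{Sha}_C(A)$. -/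

import Mathlib

open scoped TensorProduct DirectSum

noncomputable section

/-- A Baxter operator of weight `lam` on a commutative `C`-algebra `R`: a `C`-linear map `P` with
`P(x)P(y) = P(xP(y)) + P(P(x)y) + lam P(xy)`. -/
def IsBaxterOperator {C R : Type*} [CommRing C] [CommRing R] [Algebra C R] (lam : C)
    (P : R →ₗ[C] R) : Prop :=
  ∀ x y : R, P x * P y = P (x * P y) + P (P x * y) + lam • P (x * y)

/-- A Baxter ideal of an algebra with operator `P`: an ideal stable under `P`. -/
def IsBaxterIdeal {C R : Type*} [CommRing C] [CommRing R] [Algebra C R]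
    (P : R →ₗ[C] R) (I : Ideal R) : Prop :=
  ∀ x ∈ I, P x ∈ I

/-- The Baxter ideal generated by a set `S`: the smallest Baxter ideal that contains `S`. -/
def baxterIdealSpan {C R : Type*} [CommRing C] [CommRing R] [Algebra C R]
    (P : R →ₗ[C] R) (S : Set R) : Ideal R :=
  sInf {I : Ideal R | IsBaxterIdeal P I ∧ S ⊆ I}

namespace MixableShuffle

section TensorPowers

variable {C A : Type*} [CommRing C] [CommRing A] [Algebra C A]

/-- `a, a₁ ⊗ ⋯ ⊗ aₙ ↦ a ⊗ a₁ ⊗ ⋯ ⊗ aₙ`. -/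
def prepend (C : Type*) {A : Type*} [CommRing C] [CommRing A] [Algebra C A] (n : ℕ) :
    A →ₗ[C] (⨂[C]^n A) →ₗ[C] (⨂[C]^(n + 1) A) :=
  (PiTensorProduct.lift (R := C) (s := fun _ : Fin n => A)
      (E := ⨂[C]^(n + 1) A)).toLinearMap ∘ₗ
    (PiTensorProduct.tprod C (s := fun _ : Fin (n + 1) => A)).curryLeft

theorem prepend_tprod (n : ℕ) (a : A) (v : Fin n → A) :
    prepend C n a (PiTensorProduct.tprod C v) =
      PiTensorProduct.tprod C (Fin.cons a v : Fin (n + 1) → A) := by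
  simp [prepend]

/-- `a₀ ⊗ a₁ ⊗ ⋯ ⊗ aₙ ↦ a₀ ⊗ (a₁ ⊗ ⋯ ⊗ aₙ)`, splitting off the first tensor factor. -/
def headTail (C A : Type*) [CommRing C] [CommRing A] [Algebra C A] (n : ℕ) :
    (⨂[C]^(n + 1) A) →ₗ[C] A ⊗[C] (⨂[C]^n A) :=
  PiTensorProduct.lift (LinearMap.uncurryLeft (M := fun _ : Fin (n + 1) => A)
    { toFun := fun a => (TensorProduct.mk C A (⨂[C]^n A) a).compMultilinearMap
        (PiTensorProduct.tprod C)
      map_add' := fun a b => by ext; simp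
      map_smul' := fun c a => by ext; simp [TensorProduct.smul_tmul'] })

theorem headTail_prepend (n : ℕ) (a : A) (x : ⨂[C]^n A) :
    headTail C A n (prepend C n a x) = a ⊗ₜ[C] x := by
  have h : headTail C A n ∘ₗ prepend C n a = TensorProduct.mk C A (⨂[C]^n A) a := by
    ext v
    simp [headTail, prepend_tprod]
  exact LinearMap.congr_fun h x

/-- `a, a₀ ⊗ a₁ ⊗ ⋯ ⊗ aₙ ↦ a a₀ ⊗ a₁ ⊗ ⋯ ⊗ aₙ`. -/
def headMul (C A : Type*) [CommRing C] [CommRing A] [Algebra C A] (n : ℕ) :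
    A →ₗ[C] (⨂[C]^(n + 1) A) →ₗ[C] (⨂[C]^(n + 1) A) :=
  (((TensorProduct.mapBilinear (RingHom.id C) A (⨂[C]^n A) A (⨂[C]^n A)).flip LinearMap.id ∘ₗ
    LinearMap.mul C A).compr₂ (TensorProduct.lift (prepend C n))).compl₂ (headTail C A n)

theorem headMul_prepend (n : ℕ) (a b : A) (x : ⨂[C]^n A) :
    headMul C A n a (prepend C n b x) = prepend C n (a * b) x := by
  simp [headMul, headTail_prepend]

/-- The identification `A^{⊗1} = A`. -/
def tensorOne (C A : Type*) [CommRing C] [CommRing A] [Algebra C A] :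
    (⨂[C]^1 A) →ₗ[C] A :=
  (PiTensorProduct.subsingletonEquiv (R := C) (s := fun _ : Fin 1 => A) 0).toLinearMap

end TensorPowers

end MixableShuffle

/-- The underlying module `⨁_{n ≥ 1} A^{⊗n}` of the mixable shuffle Baxter algebra of weight `lam`
on the `C`-algebra `A`; the summand with index `n : ℕ` is `A^{⊗(n+1)}`. The weight only enters the
multiplication. -/
def Sha {C : Type*} [CommRing C] (_lam : C) (A : Type*) [CommRing A] [Algebra C A] :=
  ⨁ n : ℕ, ⨂[C]^(n + 1) A

namespace Sha

open MixableShuffle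

variable {C A : Type*} [CommRing C] [CommRing A] [Algebra C A] {lam : C}

instance : AddCommGroup (Sha lam A) :=
  inferInstanceAs (AddCommGroup (⨁ n : ℕ, ⨂[C]^(n + 1) A))

instance : Module C (Sha lam A) :=
  inferInstanceAs (Module C (⨁ n : ℕ, ⨂[C]^(n + 1) A))

/-- The inclusion of `A^{⊗(n+1)}`. -/
def incl (lam : C) (A : Type*) [CommRing A] [Algebra C A] (n : ℕ) :
    (⨂[C]^(n + 1) A) →ₗ[C] Sha lam A :=
  DirectSum.lof C ℕ (fun n => ⨂[C]^(n + 1) A) n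

/-- The linear map on the direct sum with given restrictions to the summands. -/
def lift (lam : C) {A M : Type*} [CommRing A] [Algebra C A] [AddCommGroup M] [Module C M]
    (f : ∀ n : ℕ, (⨂[C]^(n + 1) A) →ₗ[C] M) : Sha lam A →ₗ[C] M :=
  DirectSum.toModule C ℕ M f

theorem lift_incl {M : Type*} [AddCommGroup M] [Module C M]
    (f : ∀ n : ℕ, (⨂[C]^(n + 1) A) →ₗ[C] M) (n : ℕ) (x : ⨂[C]^(n + 1) A) :
    lift lam f (incl lam A n x) = f n x :=
  DirectSum.toModule_lof (M := fun n : ℕ => ⨂[C]^(n + 1) A) C (φ := f) n x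

/-- The pure tensor `a₀ ⊗ ⋯ ⊗ aₙ`. -/
def pure (lam : C) {n : ℕ} (a : Fin (n + 1) → A) : Sha lam A :=
  incl lam A n (PiTensorProduct.tprod C a)

/-- `a, x ↦ a ⊗ x`, on homogeneous tensors `a, a₁ ⊗ ⋯ ⊗ aₙ ↦ a ⊗ a₁ ⊗ ⋯ ⊗ aₙ`. -/
def cons (lam : C) (A : Type*) [CommRing A] [Algebra C A] :
    A →ₗ[C] Sha lam A →ₗ[C] Sha lam A :=
  LinearMap.flip (lift lam fun n =>
    ((prepend C (n + 1)).compr₂ (incl lam A (n + 1))).flip)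

theorem cons_incl (a : A) (n : ℕ) (x : ⨂[C]^(n + 1) A) :
    cons lam A a (incl lam A n x) = incl lam A (n + 1) (prepend C (n + 1) a x) := by
  simp [cons, lift_incl]

/-- The mixable shuffle product on `A^{⊗(m+1)} × A^{⊗(n+1)}`, by recursion:
* `a₀ ◇ (b₀ ⊗ y) = a₀ b₀ ⊗ y` and `(a₀ ⊗ x) ◇ b₀ = a₀ b₀ ⊗ x`;
* `(a₀ ⊗ x) ◇ (b₀ ⊗ y) = a₀ b₀ ⊗ (x ◇ (1 ⊗ y) + (1 ⊗ x) ◇ y + lam (x ◇ y))`. -/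
def shuffle (lam : C) (A : Type*) [CommRing A] [Algebra C A] : (m n : ℕ) →
    (⨂[C]^(m + 1) A) →ₗ[C] (⨂[C]^(n + 1) A) →ₗ[C] Sha lam A
  | 0, n => ((headMul C A n).compr₂ (incl lam A n)) ∘ₗ tensorOne C A
  | m + 1, 0 => (((headMul C A (m + 1)).compr₂ (incl lam A (m + 1))) ∘ₗ tensorOne C A).flip
  | m + 1, n + 1 =>
    ((TensorProduct.map₂ (LinearMap.mul C A)
      ((shuffle lam A m (n + 1)).compl₂ (prepend C (n + 1) 1) +
        shuffle lam A (m + 1) n ∘ₗ prepend C (m + 1) 1 +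
        lam • shuffle lam A m n)).compr₂ (TensorProduct.lift (cons lam A))).compl₁₂
      (headTail C A (m + 1)) (headTail C A (n + 1))
termination_by m n => m + n

/-- The mixable shuffle product, extended bilinearly. -/
def mulBilin (lam : C) (A : Type*) [CommRing A] [Algebra C A] :
    Sha lam A →ₗ[C] Sha lam A →ₗ[C] Sha lam A :=
  lift lam fun m => LinearMap.flip (lift lam fun n => (shuffle lam A m n).flip)

theorem mulBilin_incl (m n : ℕ) (x : ⨂[C]^(m + 1) A) (y : ⨂[C]^(n + 1) A) :
    mulBilin lam A (incl lam A m x) (incl lam A n y) = shuffle lam A m n x y := by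
  simp [mulBilin, lift_incl]

instance : Mul (Sha lam A) := ⟨fun x y => mulBilin lam A x y⟩

theorem mul_def (x y : Sha lam A) : x * y = mulBilin lam A x y := rfl

instance : One (Sha lam A) := ⟨pure lam (fun _ : Fin 1 => (1 : A))⟩

theorem induction_on {p : Sha lam A → Prop} (x : Sha lam A) (zero : p 0)
    (incl : ∀ n x, p (incl lam A n x)) (add : ∀ x y, p x → p y → p (x + y)) : p x :=
  DirectSum.induction_on x zero incl add

/-- Every tensor of degree `n + 1` is a sum of tensors `a ⊗ x`. -/
theorem tensor_induction {n : ℕ} {p : (⨂[C]^(n + 1) A) → Prop} (x : ⨂[C]^(n + 1) A)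
    (prep : ∀ a x, p (prepend C n a x)) (add : ∀ x y, p x → p y → p (x + y)) : p x := by
  induction x using PiTensorProduct.induction_on with
  | smul_tprod r v =>
    have := prep (r • v 0) (PiTensorProduct.tprod C (Fin.tail v))
    rwa [map_smul, LinearMap.smul_apply, prepend_tprod, Fin.cons_self_tail] at this
  | add x y hx hy => exact add x y hx hy

theorem tensor_one_induction {p : (⨂[C]^1 A) → Prop} (x : ⨂[C]^1 A)
    (pure : ∀ a : A, p (PiTensorProduct.tprod C fun _ => a)) : p x := by
  obtain ⟨a, rfl⟩ := (PiTensorProduct.subsingletonEquiv (R := C)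
    (s := fun _ : Fin 1 => A) 0).symm.surjective x
  rw [PiTensorProduct.subsingletonEquiv_symm_apply']
  exact pure a

theorem tensorOne_tprod (a : A) :
    tensorOne C A (PiTensorProduct.tprod C fun _ => a) = a := by
  simp [tensorOne]

theorem pure_one_mul_incl (a b : A) (n : ℕ) (x : ⨂[C]^n A) :
    pure lam (fun _ : Fin 1 => a) * incl lam A n (prepend C n b x) =
      incl lam A n (prepend C n (a * b) x) := by
  rw [mul_def, pure, mulBilin_incl, shuffle]
  simp [tensorOne_tprod, headMul_prepend]

theorem pure_one_mul_pure_one (a b : A) :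
    pure lam (fun _ : Fin 1 => a) * pure lam (fun _ : Fin 1 => b) =
      pure lam (fun _ : Fin 1 => a * b) := by
  have h := fun c : A => prepend_tprod (C := C) 0 c Fin.elim0
  have e : ∀ c : A, (Fin.cons c Fin.elim0 : Fin (0 + 1) → A) = fun _ => c := by
    intro c; funext i; rw [Fin.fin_one_eq_zero i]; rfl
  simp only [e] at h
  rw [pure.eq_def lam (fun _ : Fin 1 => b), pure.eq_def lam (fun _ : Fin 1 => a * b),
    ← h b, ← h (a * b)]
  exact pure_one_mul_incl a b 0 _

/-- The recursion for the product of two tensors of degree at least two. -/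
theorem cons_mul_cons (a b : A) (x y : Sha lam A) :
    cons lam A a x * cons lam A b y =
      cons lam A (a * b) (x * cons lam A 1 y + cons lam A 1 x * y + lam • (x * y)) := by
  induction x using induction_on with
  | zero => simp [mul_def]
  | add x x' hx hx' =>
    simp only [mul_def, map_add, LinearMap.add_apply, smul_add] at hx hx' ⊢
    rw [hx, hx']
    abel
  | incl m x =>
    induction y using induction_on with
    | zero => simp [mul_def]
    | add y y' hy hy' =>
      simp only [mul_def, map_add, smul_add] at hy hy' ⊢
      rw [hy, hy']
      abel
    | incl n y =>
      simp only [cons_incl, mul_def, mulBilin_incl]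
      rw [shuffle]
      simp [headTail_prepend]

theorem zero_mul' (x : Sha lam A) : 0 * x = 0 := by simp [mul_def]
theorem mul_zero' (x : Sha lam A) : x * 0 = 0 := by simp [mul_def]
theorem add_mul' (x y z : Sha lam A) : (x + y) * z = x * z + y * z := by simp [mul_def]
theorem mul_add' (x y z : Sha lam A) : x * (y + z) = x * y + x * z := by simp [mul_def]
theorem smul_mul' (c : C) (x y : Sha lam A) : (c • x) * y = c • (x * y) := by simp [mul_def]
theorem mul_smul' (c : C) (x y : Sha lam A) : x * (c • y) = c • (x * y) := by simp [mul_def]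

theorem incl_mul_comm (N : ℕ) : ∀ m n : ℕ, m + n ≤ N → ∀ (x : ⨂[C]^(m + 1) A)
    (y : ⨂[C]^(n + 1) A), incl lam A m x * incl lam A n y = incl lam A n y * incl lam A m x := by
  induction N with
  | zero =>
    intro m n h x y
    obtain ⟨rfl, rfl⟩ : m = 0 ∧ n = 0 := by omega
    induction x using tensor_one_induction with | pure a
    induction y using tensor_one_induction with | pure b
    exact (pure_one_mul_pure_one a b).trans
      ((congrArg _ (funext fun _ => mul_comm a b)).trans (pure_one_mul_pure_one b a).symm)
  | succ N ih =>
    intro m n h x y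
    rcases m with _ | m
    · rcases n with _ | n
      · exact ih 0 0 (by omega) x y
      · rw [mul_def, mul_def, mulBilin_incl, mulBilin_incl, shuffle, shuffle]
        rfl
    · rcases n with _ | n
      · rw [mul_def, mul_def, mulBilin_incl, mulBilin_incl, shuffle, shuffle]
        rfl
      · induction x using tensor_induction with
        | add x x' hx hx' => rw [map_add, add_mul', mul_add', hx, hx']
        | prep a x =>
          induction y using tensor_induction with
          | add y y' hy hy' => rw [map_add, add_mul', mul_add', hy, hy']
          | prep b y =>
            rw [← cons_incl, ← cons_incl, cons_mul_cons, cons_mul_cons, cons_incl, cons_incl,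
              ih m (n + 1) (by omega), ih (m + 1) n (by omega), ih m n (by omega), mul_comm a b,
              add_comm (incl lam A (n + 1) _ * _)]

theorem mul_comm' (x y : Sha lam A) : x * y = y * x := by
  induction x using induction_on with
  | zero => rw [zero_mul', mul_zero']
  | add x x' hx hx' => rw [add_mul', mul_add', hx, hx']
  | incl m x =>
    induction y using induction_on with
    | zero => rw [zero_mul', mul_zero']
    | add y y' hy hy' => rw [add_mul', mul_add', hy, hy']
    | incl n y => exact incl_mul_comm (m + n) m n le_rfl x y

theorem one_mul' (x : Sha lam A) : 1 * x = x := by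
  induction x using induction_on with
  | zero => rw [mul_zero']
  | add x x' hx hx' => rw [mul_add', hx, hx']
  | incl n x =>
    induction x using tensor_induction with
    | add x x' hx hx' => rw [map_add, mul_add', hx, hx']
    | prep a x => exact (pure_one_mul_incl 1 a n x).trans (by rw [one_mul])

theorem pure_one_mul_cons (a b : A) (x : Sha lam A) :
    pure lam (fun _ : Fin 1 => a) * cons lam A b x = cons lam A (a * b) x := by
  induction x using induction_on with
  | zero => simp [mul_zero']
  | add x x' hx hx' => rw [map_add, mul_add', hx, hx', map_add]
  | incl n x => rw [cons_incl, pure_one_mul_incl, cons_incl]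

theorem induction_cons {p : Sha lam A → Prop} (x : Sha lam A) (zero : p 0)
    (pure : ∀ a : A, p (pure lam (fun _ : Fin 1 => a))) (cons : ∀ a x, p (cons lam A a x))
    (add : ∀ x y, p x → p y → p (x + y)) : p x := by
  induction x using induction_on with
  | zero => exact zero
  | add x y hx hy => exact add x y hx hy
  | incl n x =>
    rcases n with _ | n
    · induction x using tensor_one_induction with | pure a
      exact pure a
    · induction x using tensor_induction with
      | add x y hx hy => rw [map_add]; exact add _ _ hx hy
      | prep a x => rw [← cons_incl]; exact cons _ _

theorem pure_one_mul_assoc (a : A) (y z : Sha lam A) :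
    pure lam (fun _ : Fin 1 => a) * y * z = pure lam (fun _ : Fin 1 => a) * (y * z) := by
  induction y using induction_cons with
  | zero => simp [mul_zero', zero_mul']
  | add y y' hy hy' => rw [mul_add', add_mul', hy, hy', add_mul', mul_add']
  | pure b =>
    induction z using induction_cons with
    | zero => simp [mul_zero']
    | add y y' hy hy' => rw [mul_add', hy, hy', mul_add', mul_add']
    | pure c => simp only [pure_one_mul_pure_one, mul_assoc]
    | cons c z => simp only [pure_one_mul_pure_one, pure_one_mul_cons, mul_assoc]
  | cons b y =>
    induction z using induction_cons with
    | zero => simp [mul_zero']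
    | add y y' hy hy' => rw [mul_add', hy, hy', mul_add', mul_add']
    | pure c =>
      rw [pure_one_mul_cons, mul_comm', pure_one_mul_cons, mul_comm' (cons lam A b y),
        pure_one_mul_cons, pure_one_mul_cons, mul_left_comm]
    | cons c z => rw [pure_one_mul_cons, cons_mul_cons, cons_mul_cons, pure_one_mul_cons, mul_assoc]

theorem incl_mul_assoc (N : ℕ) : ∀ k m n : ℕ, k + m + n ≤ N → ∀ (x : ⨂[C]^(k + 1) A)
    (y : ⨂[C]^(m + 1) A) (z : ⨂[C]^(n + 1) A),
    incl lam A k x * incl lam A m y * incl lam A n z =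
      incl lam A k x * (incl lam A m y * incl lam A n z) := by
  induction N with
  | zero =>
    intro k m n h x y z
    obtain ⟨rfl, rfl, rfl⟩ : k = 0 ∧ m = 0 ∧ n = 0 := by omega
    induction x using tensor_one_induction with | pure a
    exact pure_one_mul_assoc a _ _
  | succ N ih =>
    intro k m n h x y z
    rcases k with _ | k
    · induction x using tensor_one_induction with | pure a
      exact pure_one_mul_assoc a _ _
    rcases m with _ | m
    · induction y using tensor_one_induction with | pure a
      have h := fun y z : Sha lam A => pure_one_mul_assoc a y z
      simp only [pure.eq_def] at h
      rw [mul_comm' (incl lam A (k + 1) x), h, mul_comm' (incl lam A (k + 1) x) (_ * _), h,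
        mul_comm' (incl lam A (k + 1) x)]
    rcases n with _ | n
    · induction z using tensor_one_induction with | pure a
      have h := fun y z : Sha lam A => pure_one_mul_assoc a y z
      simp only [pure.eq_def] at h
      rw [mul_comm', mul_comm' (incl lam A (m + 1) y) (incl lam A 0 _),
        mul_comm' (incl lam A (k + 1) x) (_ * incl lam A (m + 1) y), h,
        mul_comm' (incl lam A (k + 1) x)]
    induction x using tensor_induction with
    | add x x' hx hx' => simp only [map_add, add_mul', hx, hx']
    | prep a x =>
    induction y using tensor_induction with
    | add x x' hx hx' => simp only [map_add, add_mul', mul_add', hx, hx']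
    | prep b y =>
    induction z using tensor_induction with
    | add x x' hx hx' => simp only [map_add, mul_add', hx, hx']
    | prep c z =>
    simp only [← cons_incl, cons_mul_cons, mul_assoc]
    congr 1
    have e (x y : Sha lam A) : cons lam A 1 (x * cons lam A 1 y + cons lam A 1 x * y +
        lam • (x * y)) = cons lam A 1 x * cons lam A 1 y := by rw [cons_mul_cons, mul_one]
    rw [e, e]
    simp only [cons_incl, add_mul', mul_add', smul_mul', mul_smul', smul_add]
    rw [ih k (m + 1) (n + 1) (by omega), ih (k + 1) m (n + 1) (by omega),
      ih k m (n + 1) (by omega), ih (k + 1) (m + 1) n (by omega), ih k (m + 1) n (by omega),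
      ih (k + 1) m n (by omega), ih k m n (by omega)]
    abel

theorem mul_assoc' (x y z : Sha lam A) : x * y * z = x * (y * z) := by
  induction x using induction_on with
  | zero => simp only [zero_mul']
  | add x x' hx hx' => simp only [add_mul', hx, hx']
  | incl k x =>
  induction y using induction_on with
  | zero => simp only [zero_mul', mul_zero']
  | add x x' hx hx' => simp only [add_mul', mul_add', hx, hx']
  | incl m y =>
  induction z using induction_on with
  | zero => simp only [mul_zero']
  | add x x' hx hx' => simp only [mul_add', hx, hx']
  | incl n z => exact incl_mul_assoc _ k m n le_rfl x y z

/-- `⨁_{n ≥ 1} A^{⊗n}` with the mixable shuffle product is a commutative ring, with unit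
`1 ∈ A = A^{⊗1}`. -/
instance : CommRing (Sha lam A) where
  __ := (inferInstance : AddCommGroup (Sha lam A))
  zero_mul := zero_mul'
  mul_zero := mul_zero'
  left_distrib := mul_add'
  right_distrib := add_mul'
  mul_assoc := mul_assoc'
  mul_comm := mul_comm'
  one_mul := one_mul'
  mul_one x := (mul_comm' x 1).trans (one_mul' x)

instance : Algebra C (Sha lam A) :=
  Algebra.ofModule smul_mul' (fun c x y => mul_smul' c x y)

/-- The Baxter operator `P(a₁ ⊗ ⋯ ⊗ aₙ) = 1 ⊗ a₁ ⊗ ⋯ ⊗ aₙ`. -/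
def baxter (lam : C) (A : Type*) [CommRing A] [Algebra C A] : Sha lam A →ₗ[C] Sha lam A :=
  cons lam A 1

theorem baxter_pure {n : ℕ} (a : Fin (n + 1) → A) :
    baxter lam A (pure lam a) = pure lam (Fin.cons 1 a : Fin (n + 2) → A) := by
  rw [baxter, pure, cons_incl, prepend_tprod, pure]

theorem isBaxterOperator_baxter : IsBaxterOperator lam (baxter lam A) := by
  intro x y
  simp only [baxter, cons_mul_cons, mul_one, map_add, map_smul]

/-- The canonical `C`-algebra homomorphism `A → Sha lam A`, the inclusion of `A^{⊗1} = A`. -/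
def of (lam : C) (A : Type*) [CommRing A] [Algebra C A] : A →ₐ[C] Sha lam A :=
  AlgHom.ofLinearMap
    (incl lam A 0 ∘ₗ (PiTensorProduct.subsingletonEquiv (R := C)
      (s := fun _ : Fin 1 => A) 0).symm.toLinearMap)
    (by simp [PiTensorProduct.subsingletonEquiv_symm_apply']; rfl)
    (fun a b => by
      simp only [LinearMap.comp_apply, LinearEquiv.coe_coe,
        PiTensorProduct.subsingletonEquiv_symm_apply']
      exact (pure_one_mul_pure_one a b).symm)

theorem of_apply (a : A) : of lam A a = pure lam (fun _ : Fin 1 => a) := by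
  simp only [of, AlgHom.ofLinearMap_apply, LinearMap.comp_apply, LinearEquiv.coe_coe,
    PiTensorProduct.subsingletonEquiv_symm_apply']
  rfl

end Sha

end

/-! For a Baxter operator `P` of weight `lam`, put `x ⋆ y = x P(y) + P(x) y + lam x y`. Both `P` and
`P + lam` turn `⋆` into the ordinary product, so one element `z`, the `p`-th `⋆`-power of `x`,
satisfies `P(x)^p = P(z)` and `(P(x) + lam x)^p = P(z) + lam z`. Modulo `p` the left side of the
second identity is `P(x)^p + lam^p x^p`. Cancelling `P(z)` and dividing by `lam` gives `z ≡
lam^(p-1) x^p`, and applying `P` gives `P(x)^p ≡ lam^(p-1) P(x^p)`.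

In the shuffle algebra `a ⊗ x = a P(x)`, so this congruence carries an induction on tensor length.
For pure tensors every further factor contributes one `lam^(p-1)`. Modulo a Baxter ideal containing
`p` and all `a^p - a`, these scalars disappear, because `lam` itself comes from `A`; the Frobenius
is additive there, so pure tensors suffice. -/

section Baxter

/-! ### Frobenius and Baxter operators -/

variable {C R : Type*} [CommRing C] [CommRing R] [Algebra C R] {lam : C} {P : R →ₗ[C] R}

/-- The powers of `P x` and of `P x + lam x` are images of one element, the power of `x` for the
product `x P(y) + P(x) y + lam x y`. -/
theorem IsBaxterOperator.exists_pow_succ (hP : IsBaxterOperator lam P) (x : R) (n : ℕ) :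
    ∃ z, P x ^ (n + 1) = P z ∧ (P x + lam • x) ^ (n + 1) = P z + lam • z := by
  induction n with
  | zero => exact ⟨x, by simp, by simp⟩
  | succ n ih =>
    obtain ⟨z, h₁, h₂⟩ := ih
    refine ⟨z * P x + P z * x + lam • (z * x), ?_, ?_⟩
    · rw [pow_succ, h₁, hP, map_add, map_add, map_smul]
    · rw [pow_succ, h₂, map_add, map_add, map_smul, ← hP]
      simp only [Algebra.smul_def]
      ring

/-- For a Baxter operator of invertible weight, `P(x)^p ≡ lam^(p-1) P(x^p)` modulo `p`. -/
theorem IsBaxterOperator.natCast_dvd_pow_prime_sub (hP : IsBaxterOperator lam P)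
    (hlam : IsUnit lam) {p : ℕ} (hp : p.Prime) (x : R) :
    (p : R) ∣ P x ^ p - lam ^ (p - 1) • P (x ^ p) := by
  obtain ⟨z, h₁, h₂⟩ := hP.exists_pow_succ x (p - 1)
  rw [Nat.sub_add_cancel hp.one_le] at h₁ h₂
  obtain ⟨r, hr⟩ := exists_add_pow_prime_eq hp (P x) (lam • x)
  obtain ⟨u, rfl⟩ := hlam
  rw [h₂, h₁, smul_pow] at hr
  rw [mul_assoc, mul_assoc, add_assoc] at hr
  -- `P z` is cancelled from both sides, leaving `lam z = lam^p x^p + p(⋯)`; dividing by `lam` and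
  -- applying `P` gives the claim.
  have hz := congrArg (P <| (↑u⁻¹ : C) • ·) (add_left_cancel hr)
  simp only [smul_add, smul_smul, Units.inv_mul, one_smul, ← mul_pow_sub_one hp.ne_zero (u : C),
    Units.inv_mul_cancel_left, map_add, map_smul, ← nsmul_eq_mul, map_nsmul] at hz
  rw [h₁, hz, add_sub_cancel_left, smul_comm, nsmul_eq_mul]
  exact dvd_mul_right _ _

/-! ### Baxter ideals and congruences -/

theorem IsBaxterIdeal.map_sub_mem {I : Ideal R} (hI : IsBaxterIdeal P I) {x y : R}
    (h : x - y ∈ I) : P x - P y ∈ I := by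
  rw [← map_sub]
  exact hI _ h

theorem isBaxterIdeal_baxterIdealSpan (P : R →ₗ[C] R) (S : Set R) :
    IsBaxterIdeal P (baxterIdealSpan P S) := by
  intro x hx
  simp only [baxterIdealSpan, Submodule.mem_sInf] at hx ⊢
  exact fun I hI => hI.1 x (hx I hI)

theorem subset_baxterIdealSpan (P : R →ₗ[C] R) (S : Set R) :
    S ⊆ baxterIdealSpan P S := by
  intro x hx
  simp only [baxterIdealSpan, SetLike.mem_coe, Submodule.mem_sInf]
  exact fun I hI => hI.2 hx

/-- Additivity of `P` lets integer multiples pass through it, so congruences modulo `p` survive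
applying `P`. -/
theorem isBaxterIdeal_span_natCast (P : R →ₗ[C] R) (n : ℕ) :
    IsBaxterIdeal P (Ideal.span {(n : R)}) := by
  intro x hx
  rw [Ideal.mem_span_singleton] at hx ⊢
  obtain ⟨y, rfl⟩ := hx
  exact ⟨P y, by rw [← nsmul_eq_mul, map_nsmul, nsmul_eq_mul]⟩

theorem add_pow_prime_sub_mem {I : Ideal R} {p : ℕ} (hp : p.Prime) (hpI : (p : R) ∈ I) (x y : R) :
    (x + y) ^ p - (x ^ p + y ^ p) ∈ I := by
  obtain ⟨r, hr⟩ := exists_add_pow_prime_eq hp x y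
  rw [hr, add_sub_cancel_left, mul_assoc, mul_assoc]
  exact I.mul_mem_right _ hpI

end Baxter

/-! ### The mixable shuffle algebra -/

namespace Sha

open MixableShuffle

variable {C A : Type*} [CommRing C] [CommRing A] [Algebra C A] {lam : C}

/-- Reduces tensors to elements of `A`, products and the Baxter operator, where the congruence for
`P(x)^p` applies. -/
theorem cons_eq_of_mul_baxter (a : A) (x : Sha lam A) :
    cons lam A a x = of lam A a * baxter lam A x := by
  rw [of_apply, baxter, pure_one_mul_cons, mul_one]

theorem pure_succ {n : ℕ} (a : Fin (n + 2) → A) :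
    pure lam a = of lam A (a 0) * baxter lam A (pure lam (Fin.tail a)) := by
  rw [← cons_eq_of_mul_baxter, pure, pure, cons_incl, prepend_tprod, Fin.cons_self_tail]

theorem pure_zero (a : Fin 1 → A) : pure lam a = of lam A (a 0) := by
  rw [of_apply]
  congr 1
  funext i
  rw [Fin.fin_one_eq_zero i]

/-- Building a tensor with `n + 1` factors takes `n` applications of the operator, each costing
`lam^(p-1)`. -/
theorem pure_pow_prime_sub_mem {p : ℕ} (hp : p.Prime) (hlam : IsUnit lam) (n : ℕ)
    (a : Fin (n + 1) → A) :
    pure lam a ^ p - lam ^ (n * (p - 1)) • pure lam (fun i => a i ^ p) ∈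
      Ideal.span {(p : Sha lam A)} := by
  induction n with
  | zero => simp [pure_zero]
  | succ n ih =>
    have h₁ := Ideal.mem_span_singleton.2
      (isBaxterOperator_baxter.natCast_dvd_pow_prime_sub hlam hp (pure lam (Fin.tail a)))
    have h₂ := (isBaxterIdeal_span_natCast (baxter lam A) p).map_sub_mem (ih (Fin.tail a))
    -- With `y` the tail, the sum telescopes from `P(y)^p` through `lam^(p-1) P(y^p)` to the
    -- operator applied to the tensor of `p`-th powers.
    have h := Ideal.mul_mem_left _ (of lam A (a 0) ^ p)
      (add_mem h₁ (Submodule.smul_of_tower_mem _ (lam ^ (p - 1)) h₂))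
    convert h using 1
    rw [pure_succ, pure_succ fun i => a i ^ p, add_one_mul, pow_add, map_smul, map_pow]
    simp only [Algebra.smul_def, Fin.tail_def, map_mul]
    ring

/-- A Baxter ideal that contains `p` and the elements `a^p - a` of `A` contains all `x^p - x`. -/
theorem pow_prime_sub_self_mem {p : ℕ} (hp : p.Prime) (hlam : IsUnit lam) {I : Ideal (Sha lam A)}
    (hI : IsBaxterIdeal (baxter lam A) I) (hpI : (p : Sha lam A) ∈ I)
    (hA : ∀ a : A, of lam A (a ^ p - a) ∈ I) (x : Sha lam A) : x ^ p - x ∈ I := by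
  have hadd {x y : Sha lam A} (hx : x ^ p - x ∈ I) (hy : y ^ p - y ∈ I) :
      (x + y) ^ p - (x + y) ∈ I := by
    convert add_mem (add_pow_prime_sub_mem hp hpI x y) (add_mem hx hy) using 1
    ring
  -- The hypothesis on `A` applied to the image of `lam` puts `(lam^p - lam) z` in `I`; dividing by
  -- `lam` leaves the claim.
  have hw (z : Sha lam A) : lam ^ (p - 1) • z - z ∈ I := by
    obtain ⟨u, rfl⟩ := hlam
    have h := I.mul_mem_right z (hA (algebraMap C A u))
    have h' := Submodule.smul_of_tower_mem I (↑u⁻¹ : C) h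
    convert h' using 1
    rw [← map_pow, ← map_sub, AlgHom.commutes, ← Algebra.smul_def, smul_smul,
      ← mul_pow_sub_one hp.ne_zero, mul_sub, Units.inv_mul_cancel_left, Units.inv_mul, sub_smul,
      one_smul]
  induction x using induction_on with
  | zero => simp [hp.ne_zero]
  | add x y hx hy => exact hadd hx hy
  | incl n x =>
    induction n with
    | zero =>
      induction x using tensor_one_induction with | pure a
      have h := hA a
      rwa [map_sub, map_pow, of_apply] at h
    | succ n ih =>
      induction x using tensor_induction with
      | add x y hx hy => rw [map_add]; exact hadd hx hy
      | prep a x =>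
        rw [← cons_incl, cons_eq_of_mul_baxter]
        have h₁ := hA a
        rw [map_sub, map_pow] at h₁
        have h₂ := I.mem_of_dvd
          (isBaxterOperator_baxter.natCast_dvd_pow_prime_sub hlam hp (incl lam A n x)) hpI
        have h₃ := Submodule.smul_of_tower_mem I (lam ^ (p - 1)) (hI.map_sub_mem (ih x))
        -- Writing `y` for the tail, the chain modulo `I` is `a^p P(y)^p ≡ a^p lam^(p-1) P(y^p) ≡
        -- a^p lam^(p-1) P(y) ≡ a^p P(y) ≡ a P(y)`.
        convert add_mem (I.mul_mem_left (of lam A a ^ p)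
          (add_mem (add_mem h₂ h₃) (hw (baxter lam A (incl lam A n x)))))
          (I.mul_mem_right (baxter lam A (incl lam A n x)) h₁) using 1
        rw [smul_sub]
        ring

end Sha

theorem theorem4p1 {C A : Type*} [CommRing C] [CommRing A] [Algebra C A]
    (p : ℕ) (hp : p.Prime) (lam : C) (hlam : IsUnit lam) :
    (∀ (n : ℕ) (a : Fin (n + 1) → A),
      (Sha.pure lam a) ^ p ≡ lam ^ (n * (p - 1)) • Sha.pure lam (fun i => a i ^ p)
        [SMOD Ideal.span {(p : Sha lam A)}]) ∧
    (lam = 1 → ∀ (n : ℕ) (a : Fin (n + 1) → A),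
      (Sha.pure lam a) ^ p ≡ Sha.pure lam (fun i => a i ^ p)
        [SMOD Ideal.span {(p : Sha lam A)}]) ∧
    (∀ x : Sha lam A,
      x ^ p ≡ x [SMOD baxterIdealSpan (Sha.baxter lam A)
        ({(p : Sha lam A)} ∪ Set.range fun a : A => Sha.of lam A (a ^ p - a))]) ∧
    (CharP A p → (∀ a : A, a ^ p = a) → ∀ x : Sha lam A, x ^ p = x) := by
  have h := fun n a => SModEq.sub_mem.2 (Sha.pure_pow_prime_sub_mem (A := A) hp hlam n a)
  refine ⟨h, ?_, fun x => SModEq.sub_mem.2 ?_, fun _ hA x => ?_⟩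
  · rintro rfl n a
    simpa using h n a
  · have hS := subset_baxterIdealSpan (Sha.baxter lam A)
      ({(p : Sha lam A)} ∪ Set.range fun a : A => Sha.of lam A (a ^ p - a))
    exact Sha.pow_prime_sub_self_mem hp hlam (isBaxterIdeal_baxterIdealSpan _ _)
      (hS (Or.inl rfl)) (fun a => hS (Or.inr ⟨a, rfl⟩)) x
  · have hp0 : (p : Sha lam A) = 0 := by
      rw [← map_natCast (Sha.of lam A), CharP.cast_eq_zero, map_zero]
    -- Here `p` and every `a^p - a` vanish, so the zero ideal already meets the requirements and the
    -- congruence becomes an equality.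
    have hI : IsBaxterIdeal (Sha.baxter lam A) ⊥ := by simp [IsBaxterIdeal]
    have hx := Sha.pow_prime_sub_self_mem hp hlam hI (by simp [hp0]) (fun a => by simp [hA]) x
    rwa [Ideal.mem_bot, sub_eq_zero] at hx
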